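/- For a finite simple graph $G$ let $\iota_m(G)$ be the number of its inclusion-maximal independent sets of vertices, and for $n\in\mathbb N$ let $L(n)$ be the minimal number of vertices of a bipartite graph $G$ with $\iota_m(G)=n$. For a binary word $w$ and an integer $q\ge 0$ let $w^{(q)}$ denote the word $w$ repeated $q$ times. Let $(n_j)_{j\ge 0}$ be a sequence of natural numbers with $n_j\to\infty$, and suppose that for every $j$ the binary representation of $n_j$ (most significant bit first, no leading zeros) is the concatenation $$w_{j,1}^{(q_{j,1})}\,w_{j,2}^{(q_{j,2})}\cdots w_{j,k_j}^{(q_{j,k_j})}$$ of powers of binary words $w_{j,i}$ of lengths $p_{j,i}$, where the number $k_j$ of words, the words and the exponents $q_{j,i}$ may all depend on $j$. If $$\sum_{i=1}^{k_j}p_{j,i}=o(\log n_j)\qquad (j\to\infty),$$ then, whatever the exponents $q_{j,i}$ are, $$L(n_j)\sim 2\log_2 n_j\qquad (j\to\infty).$$ -/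

import Mathlib

open Filter Asymptotics

/-- The number of maximal (with respect to inclusion) independent sets of vertices of `G`. -/
noncomputable def numMaxIndepSets {V : Type*} (G : SimpleGraph V) : ℕ :=
  {s : Set V | Maximal G.IsIndepSet s}.ncard

/-- The minimal number of vertices of a finite bipartite graph with exactly `n` maximal
independent sets. -/
noncomputable def minBipartiteOrder (n : ℕ) : ℕ :=
  sInf {m : ℕ | ∃ G : SimpleGraph (Fin m), G.IsBipartite ∧ numMaxIndepSets G = n}

/-- The binary representation of `n`, most significant bit first, without leading zeros. -/
def binaryRep (n : ℕ) : List Bool := n.bits.reverse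

/-- The word `w` repeated `q` times. -/
def wordPow (w : List Bool) (q : ℕ) : List Bool := (List.replicate q w).flatten

/-! Lower bound: in a bipartite graph a maximal independent set is determined by its trace on either
colour class, so `n ^ 2 ≤ 2 ^ |V|`. Upper bound: the down-sets of a preorder on `m` points are
counted by the maximal independent sets of a bipartite graph on `2 * m` vertices, so about `log₂ n`
points must suffice for `n` down-sets. Putting everything built so far below a marked point of a new
gadget turns a count `a` into `a * α + β` (`HasCount.append`), which is Horner's rule. The suffix
`w^(q)` needs `α = 2^(pq)` and `β = val w * ∑ i < q, 2^(pi)`; a chain of `q` gadgets with a copy of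
`w` attached gives this with `q * (p + 1) + O(p)` points. Using `w^(t)` as the period cuts the
excess `q` to `q / t`, and a large fixed `t` makes it negligible. -/

/-- The sets closed under a relation `r`, read as a family of implications `y ∈ S → x ∈ S`. -/
def closedSets {X : Type*} (r : X → X → Prop) : Set (Set X) :=
  {S | ∀ x y, r x y → y ∈ S → x ∈ S}

/-- Some relation on a type with at most `m` elements has exactly `a` closed sets. -/
def HasCount (m a : ℕ) : Prop :=
  ∃ (X : Type) (_ : Finite X) (r : X → X → Prop), Nat.card X ≤ m ∧ (closedSets r).ncard = a

/-- Some relation on a type with at most `m` elements has exactly `α` closed sets avoiding and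
exactly `β` closed sets containing a certain point. -/
def HasPointedCount (m α β : ℕ) : Prop :=
  ∃ (X : Type) (_ : Finite X) (r : X → X → Prop) (c : X), Nat.card X ≤ m ∧
    (closedSets r ∩ {S | c ∉ S}).ncard = α ∧ (closedSets r ∩ {S | c ∈ S}).ncard = β

/-! ### From closed sets to maximal independent sets -/

/-- The graph on two copies of `X` in which a point of the first copy is joined to the points of
the second copy that lie below it. -/
def comparabilityGraph {V X : Type*} (r : X → X → Prop) (e : V ≃ X ⊕ X) : SimpleGraph V where
  Adj u v := (∃ a b, e u = .inl a ∧ e v = .inr b ∧ Relation.ReflTransGen r b a) ∨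
    (∃ a b, e v = .inl a ∧ e u = .inr b ∧ Relation.ReflTransGen r b a)
  symm := ⟨fun _ _ h => h.symm⟩
  loopless := ⟨fun u h => by
    rcases h with ⟨a, b, h1, h2, -⟩ | ⟨a, b, h1, h2, -⟩ <;> simp [h1] at h2⟩

theorem comparabilityGraph_isBipartite {V X : Type*} (r : X → X → Prop) (e : V ≃ X ⊕ X) :
    (comparabilityGraph r e).IsBipartite := by
  refine ⟨SimpleGraph.Coloring.mk (fun v => if (e v).isLeft then 0 else 1) ?_⟩
  rintro u v (⟨a, b, h1, h2, -⟩ | ⟨a, b, h1, h2, -⟩) <;> simp [h1, h2]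

theorem mem_of_reflTransGen {X : Type*} {r : X → X → Prop} {S : Set X} (hS : S ∈ closedSets r)
    {x y : X} (h : Relation.ReflTransGen r x y) (hy : y ∈ S) : x ∈ S := by
  induction h with
  | refl => exact hy
  | tail _ h2 ih => exact ih (hS _ _ h2 hy)

/-- The vertex set formed by `S` in the first copy and its complement in the second. -/
def splitSet {V X : Type*} (e : V ≃ X ⊕ X) (S : Set X) : Set V :=
  {v | Sum.elim (· ∈ S) (· ∉ S) (e v)}

theorem splitSet_injective {V X : Type*} (e : V ≃ X ⊕ X) : Function.Injective (splitSet e) := by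
  intro S T h
  ext x
  have := Set.ext_iff.1 h (e.symm (.inl x))
  simpa [splitSet] using this

theorem splitSet_isIndepSet {V X : Type*} (r : X → X → Prop) (e : V ≃ X ⊕ X) {S : Set X}
    (hS : S ∈ closedSets r) : (comparabilityGraph r e).IsIndepSet (splitSet e S) := by
  rintro u hu v hv - (⟨a, b, h1, h2, h3⟩ | ⟨a, b, h1, h2, h3⟩)
  · simp only [splitSet, Set.mem_ofPred_eq, h1, h2, Sum.elim_inl, Sum.elim_inr] at hu hv
    exact hv (mem_of_reflTransGen hS h3 hu)
  · simp only [splitSet, Set.mem_ofPred_eq, h1, h2, Sum.elim_inl, Sum.elim_inr] at hu hv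
    exact hu (mem_of_reflTransGen hS h3 hv)

theorem setOf_maximal_comparabilityGraph {V X : Type*} (r : X → X → Prop) (e : V ≃ X ⊕ X) :
    {s | Maximal (comparabilityGraph r e).IsIndepSet s} = splitSet e '' closedSets r := by
  ext s
  constructor
  · intro hs
    -- The down-closure of the trace on the first copy; its split set is independent and contains
    -- `s`, hence equals it.
    let S : Set X := {b | ∃ a, e.symm (.inl a) ∈ s ∧ Relation.ReflTransGen r b a}
    have hS : S ∈ closedSets r := by
      rintro x y hxy ⟨a, ha, hya⟩
      exact ⟨a, ha, .head hxy hya⟩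
    refine ⟨S, hS, (hs.eq_of_subset (splitSet_isIndepSet r e hS) ?_).symm⟩
    intro v hv
    rcases h : e v with a | b
    · simp only [splitSet, Set.mem_ofPred_eq, h, Sum.elim_inl]
      exact ⟨a, by simpa [← h] using hv, .refl⟩
    · simp only [splitSet, Set.mem_ofPred_eq, h, Sum.elim_inr]
      rintro ⟨a, ha, hba⟩
      refine hs.prop ha hv ?_ (.inl ⟨a, b, by simp, h, hba⟩)
      rintro rfl
      simp at h
  · rintro ⟨S, hS, rfl⟩
    refine ⟨splitSet_isIndepSet r e hS, fun t ht hSt v hv => ?_⟩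
    by_contra hvS
    rcases h : e v with a | a
    · have haS : a ∉ S := by simpa [splitSet, h] using hvS
      have hw : e.symm (.inr a) ∈ t := hSt (by simpa [splitSet] using haS)
      -- Reflexivity of the order joins the two copies of `a`, so no split set can be enlarged.
      refine ht hv hw ?_ (.inl ⟨a, a, h, by simp, .refl⟩)
      rintro rfl
      simp at h
    · have haS : a ∈ S := by simpa [splitSet, h] using hvS
      have hw : e.symm (.inl a) ∈ t := hSt (by simpa [splitSet] using haS)
      refine ht hw hv ?_ (.inl ⟨a, a, by simp, h, .refl⟩)
      rintro rfl
      simp at h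

theorem HasCount.exists_graph {m a : ℕ} (h : HasCount m a) :
    ∃ M ≤ 2 * m, ∃ G : SimpleGraph (Fin M), G.IsBipartite ∧ numMaxIndepSets G = a := by
  obtain ⟨X, _, r, hm, ha⟩ := h
  let e : Fin (Nat.card (X ⊕ X)) ≃ X ⊕ X := (Finite.equivFin _).symm
  refine ⟨_, ?_, comparabilityGraph r e, comparabilityGraph_isBipartite r e, ?_⟩
  · rw [Nat.card_sum]; omega
  · rw [numMaxIndepSets, setOf_maximal_comparabilityGraph,
      Set.ncard_image_of_injective _ (splitSet_injective e), ha]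

theorem HasCount.minBipartiteOrder_le {m a : ℕ} (h : HasCount m a) :
    minBipartiteOrder a ≤ 2 * m := by
  obtain ⟨M, hM, hG⟩ := h.exists_graph
  exact (Nat.sInf_le hG).trans hM

/-! ### The lower bound -/

/-- In a bipartite graph a maximal independent set is determined by its trace on either class. -/
theorem numMaxIndepSets_le_two_pow {V : Type*} [Finite V] (G : SimpleGraph V) (A : Set V)
    (hA : ∀ u v, G.Adj u v → (u ∈ A ↔ v ∉ A)) : numMaxIndepSets G ≤ 2 ^ A.ncard := by
  have hinj : Set.InjOn (fun s : Set V => s ∩ A) {s | Maximal G.IsIndepSet s} := by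
    have key : ∀ s t : Set V, Maximal G.IsIndepSet s → Maximal G.IsIndepSet t →
        s ∩ A = t ∩ A → s ⊆ t := by
      intro s t hs ht hst
      have hind : G.IsIndepSet (s ∪ t) := by
        -- Each edge has an end in `A`, where `s` and `t` agree, so an edge from `s` to `t` would
        -- lie inside one of them.
        have cross : ∀ u ∈ s, ∀ v ∈ t, ¬ G.Adj u v := by
          intro u hu v hv huv
          by_cases hvA : v ∈ A
          · have : v ∈ s ∩ A := hst ▸ ⟨hv, hvA⟩
            exact hs.prop hu this.1 huv.ne huv
          · have : u ∈ t ∩ A := hst ▸ ⟨hu, (hA _ _ huv).2 hvA⟩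
            exact ht.prop this.1 hv huv.ne huv
        rintro u (hu | hu) v (hv | hv) huv
        · exact hs.prop hu hv huv
        · exact cross u hu v hv
        · exact fun h => cross v hv u hu h.symm
        · exact ht.prop hu hv huv
      have := ht.eq_of_subset hind Set.subset_union_right
      exact Set.subset_union_left.trans this.symm.subset
    intro s hs t ht hst
    exact (key s t hs ht hst).antisymm (key t s ht hs hst.symm)
  rw [← Set.ncard_powerset A]
  exact Set.ncard_le_ncard_of_injOn _ (fun s _ => Set.inter_subset_right) hinj

theorem numMaxIndepSets_sq_le {V : Type*} [Finite V] (G : SimpleGraph V) (hG : G.IsBipartite) :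
    numMaxIndepSets G ^ 2 ≤ 2 ^ Nat.card V := by
  obtain ⟨C⟩ := hG
  have hC : ∀ u v, G.Adj u v → C u ≠ C v := fun u v h => C.valid h
  have h1 := numMaxIndepSets_le_two_pow G {v | C v = 0} (fun u v h => by
    have := hC u v h
    simp only [Set.mem_ofPred_eq]
    omega)
  have h2 := numMaxIndepSets_le_two_pow G {v | C v = 0}ᶜ (fun u v h => by
    have := hC u v h
    simp only [Set.mem_compl_iff, Set.mem_ofPred_eq]
    omega)
  rw [sq, ← Set.ncard_add_ncard_compl {v | C v = 0}, pow_add]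
  exact Nat.mul_le_mul h1 h2

/-- `h` makes the set of orders nonempty, so the `sInf` is attained and is not the default `0`. -/
theorem HasCount.sq_le_two_pow {m a : ℕ} (h : HasCount m a) : a ^ 2 ≤ 2 ^ minBipartiteOrder a := by
  obtain ⟨M, -, hG⟩ := h.exists_graph
  obtain ⟨G, hG, hn⟩ := Nat.sInf_mem
    (s := {m : ℕ | ∃ G : SimpleGraph (Fin m), G.IsBipartite ∧ numMaxIndepSets G = a}) ⟨M, hG⟩
  have := numMaxIndepSets_sq_le G hG
  rwa [hn, Nat.card_fin] at this

/-! ### Operations on relations and their counts -/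

theorem HasCount.mono {m m' a : ℕ} (h : HasCount m a) (hm : m ≤ m') : HasCount m' a := by
  obtain ⟨X, i, r, hX, ha⟩ := h
  exact ⟨X, i, r, hX.trans hm, ha⟩

/-- A subset of a disjoint union as a pair of subsets. -/
def setSumEquiv (X Y : Type*) : Set (X ⊕ Y) ≃ Set X × Set Y where
  toFun S := (Sum.inl ⁻¹' S, Sum.inr ⁻¹' S)
  invFun p := {z | Sum.elim (· ∈ p.1) (· ∈ p.2) z}
  left_inv S := by ext (x | y) <;> simp
  right_inv p := by ext <;> simp

theorem ncard_of_mem_iff {X Y : Type*} (F : Set (Set (X ⊕ Y))) (F' : Set (Set X × Set Y))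
    (h : ∀ S, S ∈ F ↔ (Sum.inl ⁻¹' S, Sum.inr ⁻¹' S) ∈ F') : F.ncard = F'.ncard := by
  have : F = setSumEquiv X Y ⁻¹' F' := by
    ext S
    exact h S
  rw [this, ← Equiv.image_symm_eq_preimage,
    Set.ncard_image_of_injective _ (setSumEquiv X Y).symm.injective]

theorem closedSets_bot (X : Type*) : closedSets (fun _ _ : X => False) = Set.univ := by
  ext; simp [closedSets]

theorem hasCount_two_pow (p : ℕ) : HasCount p (2 ^ p) := by
  refine ⟨Fin p, inferInstance, fun _ _ => False, by simp, ?_⟩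
  rw [closedSets_bot, Set.ncard_univ, Nat.card_eq_fintype_card]
  simp

theorem hasCount_zero_one : HasCount 0 1 := hasCount_two_pow 0

theorem mem_closedSets_liftRel {X Y : Type*} {r : X → X → Prop} {s : Y → Y → Prop}
    {S : Set (X ⊕ Y)} : S ∈ closedSets (Sum.LiftRel r s) ↔
      Sum.inl ⁻¹' S ∈ closedSets r ∧ Sum.inr ⁻¹' S ∈ closedSets s := by
  simp [closedSets]

theorem HasCount.mul {m m' a a' : ℕ} (h : HasCount m a) (h' : HasCount m' a') :
    HasCount (m + m') (a * a') := by
  obtain ⟨X, _, r, hX, rfl⟩ := h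
  obtain ⟨Y, _, s, hY, rfl⟩ := h'
  refine ⟨X ⊕ Y, inferInstance, Sum.LiftRel r s, by rw [Nat.card_sum]; omega, ?_⟩
  rw [← Set.ncard_prod]
  exact ncard_of_mem_iff _ _ fun S => mem_closedSets_liftRel

/-- The relation on a disjoint union in which moreover the whole first summand lies below `d`. -/
def belowRel {X Y : Type*} (r : X → X → Prop) (s : Y → Y → Prop) (d : Y) :
    X ⊕ Y → X ⊕ Y → Prop :=
  fun u v => Sum.LiftRel r s u v ∨ u.isLeft ∧ v = .inr d

theorem univ_mem_closedSets {X : Type*} (r : X → X → Prop) : Set.univ ∈ closedSets r :=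
  fun _ _ _ _ => trivial

theorem empty_mem_closedSets {X : Type*} (r : X → X → Prop) : ∅ ∈ closedSets r :=
  fun _ _ _ h => h

theorem closedSets_or {X : Type*} (r s : X → X → Prop) :
    closedSets (fun x y => r x y ∨ s x y) = closedSets r ∩ closedSets s := by
  ext S
  constructor
  · exact fun h => ⟨fun x y hxy => h x y (.inl hxy), fun x y hxy => h x y (.inr hxy)⟩
  · rintro ⟨h1, h2⟩ x y (h | h)
    exacts [h1 x y h, h2 x y h]

theorem mem_closedSets_belowRel {X Y : Type*} {r : X → X → Prop} {s : Y → Y → Prop} {d : Y}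
    {S : Set (X ⊕ Y)} : S ∈ closedSets (belowRel r s d) ↔
      (Sum.inl ⁻¹' S, Sum.inr ⁻¹' S) ∈
        closedSets r ×ˢ (closedSets s ∩ {B | d ∉ B}) ∪ {Set.univ} ×ˢ (closedSets s ∩ {B | d ∈ B}) := by
  have h : S ∈ closedSets (fun u v : X ⊕ Y => u.isLeft ∧ v = .inr d) ↔
      (.inr d ∈ S → Sum.inl ⁻¹' S = Set.univ) := by
    simp only [closedSets, Set.eq_univ_iff_forall, Set.mem_ofPred_eq, Set.mem_preimage]
    refine ⟨fun h hd x => h (.inl x) _ ⟨rfl, rfl⟩ hd, ?_⟩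
    rintro h (x | y) _ ⟨hx, rfl⟩ hd
    exacts [h hd x, by simp at hx]
  have h0 := univ_mem_closedSets r
  unfold belowRel
  rw [closedSets_or, Set.mem_inter_iff, mem_closedSets_liftRel, h]
  by_cases hd : Sum.inr d ∈ S
  · simp only [hd, forall_const, Set.mem_union, Set.mem_prod, Set.mem_inter_iff, Set.mem_ofPred_eq,
      Set.mem_preimage, not_true_eq_false, and_false, Set.mem_singleton_iff, and_true, false_or]
    constructor
    · tauto
    · rintro ⟨h1, h2⟩
      exact ⟨⟨h1 ▸ h0, h2⟩, h1⟩
  · simp [hd]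

/-- If `d` is absent the two parts are independent; if `d` is present it forces all of `X`. -/
theorem HasCount.append {m m' a α β : ℕ} (h : HasCount m a) (h' : HasPointedCount m' α β) :
    HasCount (m + m') (a * α + β) := by
  obtain ⟨X, _, r, hX, rfl⟩ := h
  obtain ⟨Y, _, s, d, hY, rfl, rfl⟩ := h'
  refine ⟨X ⊕ Y, inferInstance, belowRel r s d, by rw [Nat.card_sum]; omega, ?_⟩
  rw [ncard_of_mem_iff _ _ fun S => mem_closedSets_belowRel, Set.ncard_union_eq,
    Set.ncard_prod, Set.ncard_prod, Set.ncard_singleton, one_mul]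
  rw [Set.disjoint_left]
  rintro ⟨A, B⟩ h1 h2
  exact h1.2.2 h2.2.2

/-- The marked point stays in the first part, so the sets in which `d` forces all of `X` contain it.
-/
theorem HasPointedCount.append {m m' α₀ β₀ α β : ℕ} (h : HasPointedCount m α₀ β₀)
    (h' : HasPointedCount m' α β) : HasPointedCount (m + m') (α₀ * α) (β₀ * α + β) := by
  obtain ⟨X, _, r, c, hX, rfl, rfl⟩ := h
  obtain ⟨Y, _, s, d, hY, rfl, rfl⟩ := h'
  refine ⟨X ⊕ Y, inferInstance, belowRel r s d, .inl c, by rw [Nat.card_sum]; omega, ?_, ?_⟩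
  · rw [← Set.ncard_prod]
    refine ncard_of_mem_iff _ _ fun S => ?_
    rw [Set.mem_inter_iff, mem_closedSets_belowRel]
    constructor
    · rintro ⟨h1 | h1, h2⟩
      · exact ⟨⟨h1.1, h2⟩, h1.2⟩
      · refine absurd (?_ : c ∈ Sum.inl ⁻¹' S) h2
        rw [show Sum.inl ⁻¹' S = Set.univ from h1.1]
        trivial
    · exact fun h1 => ⟨.inl ⟨h1.1.1, h1.2⟩, h1.1.2⟩
  · have hd : Disjoint ((closedSets r ∩ {S | c ∈ S}) ×ˢ (closedSets s ∩ {B | d ∉ B}))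
        (({Set.univ} : Set (Set X)) ×ˢ (closedSets s ∩ {B | d ∈ B})) := by
      rw [Set.disjoint_left]
      rintro ⟨A, B⟩ h1 h2
      exact h1.2.2 h2.2.2
    have := Set.ncard_union_eq hd
    rw [Set.ncard_prod, Set.ncard_prod, Set.ncard_singleton, one_mul] at this
    rw [← this]
    refine ncard_of_mem_iff _ _ fun S => ?_
    rw [Set.mem_inter_iff, mem_closedSets_belowRel]
    constructor
    · rintro ⟨h1 | h1, h2⟩
      · exact .inl ⟨⟨h1.1, h2⟩, h1.2⟩
      · exact .inr h1
    · rintro (h1 | h1)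
      · exact ⟨.inl ⟨h1.1.1, h1.2⟩, h1.1.2⟩
      · refine ⟨.inr h1, (?_ : c ∈ Sum.inl ⁻¹' S)⟩
        rw [show Sum.inl ⁻¹' S = Set.univ from h1.1]
        trivial

theorem hasPointedCount_one : HasPointedCount 1 1 1 := by
  refine ⟨Unit, inferInstance, fun _ _ => False, (), by simp, ?_, ?_⟩
  · rw [closedSets_bot, Set.univ_inter, Set.ncard_eq_one]
    refine ⟨∅, ?_⟩
    ext S
    rw [Set.mem_singleton_iff, Set.eq_empty_iff_forall_notMem]
    exact ⟨fun h _ => h, fun h => h ()⟩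
  · rw [closedSets_bot, Set.univ_inter, Set.ncard_eq_one]
    refine ⟨Set.univ, ?_⟩
    ext S
    rw [Set.mem_singleton_iff, Set.eq_univ_iff_forall]
    exact ⟨fun h _ => h, fun h => h ()⟩

/-- The marked point sits on top of `p` unrelated points. -/
theorem hasPointedCount_two_pow (p : ℕ) : HasPointedCount (p + 1) (2 ^ p) 1 := by
  obtain ⟨X, _, r, hX, ha⟩ := hasCount_two_pow p
  obtain ⟨Y, _, s, d, hY, h1, h2⟩ := hasPointedCount_one
  refine ⟨X ⊕ Y, inferInstance, belowRel r s d, .inr d, by rw [Nat.card_sum]; omega, ?_, ?_⟩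
  · rw [← mul_one (2 ^ p), ← ha, ← h1, ← Set.ncard_prod]
    refine ncard_of_mem_iff _ _ fun S => ?_
    rw [Set.mem_inter_iff, mem_closedSets_belowRel]
    constructor
    · rintro ⟨h1 | h1, h2⟩
      · exact h1
      · exact absurd h1.2.2 h2
    · exact fun h1 => ⟨.inl h1, h1.2.2⟩
  · rw [← h2, ← one_mul (Set.ncard (closedSets s ∩ _)), ← Set.ncard_singleton (Set.univ : Set X), ← Set.ncard_prod]
    refine ncard_of_mem_iff _ _ fun S => ?_
    rw [Set.mem_inter_iff, mem_closedSets_belowRel]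
    constructor
    · rintro ⟨h1 | h1, h2⟩
      · exact absurd h2 h1.2.2
      · exact h1
    · exact fun h1 => ⟨.inr h1, h1.2.2⟩

/-- With `c` put below all of `Y`, the part in `Y` is empty unless `c` is present, and then it is
arbitrary. -/
theorem HasPointedCount.attach {m m' α β w : ℕ} (h : HasPointedCount m α β)
    (h' : HasCount m' w) : HasPointedCount (m + m') α (β * w) := by
  obtain ⟨X, _, r, c, hX, rfl, rfl⟩ := h
  obtain ⟨Y, _, s, hY, rfl⟩ := h'
  have key : ∀ S : Set (X ⊕ Y),
      S ∈ closedSets (fun u v => Sum.LiftRel r s u v ∨ u = .inl c ∧ v.isRight) ↔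
        (Sum.inl ⁻¹' S ∈ closedSets r ∧ Sum.inr ⁻¹' S ∈ closedSets s) ∧
          (c ∉ Sum.inl ⁻¹' S → Sum.inr ⁻¹' S = ∅) := by
    intro S
    rw [closedSets_or, Set.mem_inter_iff, mem_closedSets_liftRel]
    refine and_congr_right fun _ => ?_
    simp only [closedSets, Set.mem_ofPred_eq, Sum.forall, Set.eq_empty_iff_forall_notMem,
      Set.mem_preimage]
    simp
    grind
  refine ⟨X ⊕ Y, inferInstance, fun u v => Sum.LiftRel r s u v ∨ u = .inl c ∧ v.isRight, .inl c,
    by rw [Nat.card_sum]; omega, ?_, ?_⟩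
  · rw [← mul_one (Set.ncard (closedSets r ∩ _)), ← Set.ncard_singleton (∅ : Set Y),
      ← Set.ncard_prod]
    refine ncard_of_mem_iff _ _ fun S => ?_
    rw [Set.mem_inter_iff, key]
    constructor
    · rintro ⟨⟨⟨h1, h2⟩, h3⟩, h4⟩
      exact ⟨⟨h1, h4⟩, h3 h4⟩
    · rintro ⟨⟨h1, h4⟩, h2⟩
      refine ⟨⟨⟨h1, ?_⟩, fun _ => h2⟩, h4⟩
      rw [show Sum.inr ⁻¹' S = ∅ from h2]
      exact empty_mem_closedSets s
  · rw [← Set.ncard_prod]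
    refine ncard_of_mem_iff _ _ fun S => ?_
    rw [Set.mem_inter_iff, key]
    constructor
    · rintro ⟨⟨⟨h1, h2⟩, -⟩, h4⟩
      exact ⟨⟨h1, h4⟩, h2⟩
    · rintro ⟨⟨h1, h4⟩, h2⟩
      exact ⟨⟨⟨h1, h2⟩, fun h => absurd h4 h⟩, h4⟩

/-! ### Chains of gadgets -/

theorem geomSum_succ (x q : ℕ) :
    ∑ i ∈ Finset.range (q + 1), x ^ i = (∑ i ∈ Finset.range q, x ^ i) * x + 1 := by
  rw [geom_sum_succ, mul_comm]

theorem hasCount_geomSum (p q : ℕ) :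
    HasCount ((q + 1) * (p + 1)) (∑ i ∈ Finset.range (q + 1), (2 ^ p) ^ i) := by
  induction q with
  | zero => simpa using hasCount_zero_one.mono (Nat.zero_le (p + 1))
  | succ q ih =>
    rw [geomSum_succ, add_one_mul (q + 1)]
    exact ih.append (hasPointedCount_two_pow p)

theorem hasPointedCount_geomSum (p q : ℕ) :
    HasPointedCount ((q + 1) * (p + 1)) ((2 ^ p) ^ (q + 1))
      (∑ i ∈ Finset.range (q + 1), (2 ^ p) ^ i) := by
  induction q with
  | zero => simpa using hasPointedCount_two_pow p
  | succ q ih =>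
    rw [geomSum_succ, add_one_mul (q + 1), pow_succ]
    exact ih.append (hasPointedCount_two_pow p)

/-! ### Binary words and powers of words -/

/-- The number with binary digits `l`, most significant first. -/
def wordVal (l : List Bool) : ℕ := l.foldl (fun a b => 2 * a + b.toNat) 0

theorem wordVal_concat (l : List Bool) (b : Bool) : wordVal (l ++ [b]) = 2 * wordVal l + b.toNat := by
  simp [wordVal]

theorem wordVal_append (l w : List Bool) :
    wordVal (l ++ w) = wordVal l * 2 ^ w.length + wordVal w := by
  induction w using List.reverseRecOn with
  | nil => simp [wordVal]
  | append_singleton w b ih =>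
    rw [← List.append_assoc, wordVal_concat, wordVal_concat, ih, List.length_append, pow_add]
    simp
    ring

theorem wordVal_binaryRep (n : ℕ) : wordVal (binaryRep n) = n := by
  induction n using Nat.binaryRec' with
  | zero => simp [wordVal, binaryRep]
  | bit b n h ih =>
    rw [binaryRep, Nat.bits_append_bit n b h, List.reverse_cons, wordVal_concat, ← binaryRep, ih,
      Nat.bit_val]

theorem length_binaryRep (n : ℕ) : (binaryRep n).length = n.size := by
  rw [binaryRep, List.length_reverse, Nat.size_eq_bits_len]

theorem wordPow_zero (w : List Bool) : wordPow w 0 = [] := rfl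

theorem wordPow_add (w : List Bool) (q r : ℕ) : wordPow w (q + r) = wordPow w q ++ wordPow w r := by
  rw [wordPow, List.replicate_add, List.flatten_append, ← wordPow, ← wordPow]

theorem wordPow_one (w : List Bool) : wordPow w 1 = w := by
  simp [wordPow]

theorem wordPow_mul (w : List Bool) (t q : ℕ) : wordPow w (t * q) = wordPow (wordPow w t) q := by
  induction q with
  | zero => rfl
  | succ q ih => rw [mul_add_one, wordPow_add, wordPow_add, wordPow_one, ih]

theorem length_wordPow (w : List Bool) (q : ℕ) : (wordPow w q).length = w.length * q := by
  simp [wordPow, mul_comm]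

theorem wordVal_wordPow (w : List Bool) (q : ℕ) :
    wordVal (wordPow w q) = (∑ i ∈ Finset.range q, (2 ^ w.length) ^ i) * wordVal w := by
  induction q with
  | zero => simp [wordPow_zero, wordVal]
  | succ q ih =>
    rw [wordPow_add, wordPow_one, wordVal_append, ih, geomSum_succ]
    ring

/-- Horner's rule digit by digit, at most two points each. Zero is excluded because the empty set is
always closed. -/
theorem hasCount_wordVal (w : List Bool) (hw : wordVal w ≠ 0) :
    HasCount (2 * w.length) (wordVal w) := by
  induction w using List.reverseRecOn with
  | nil => exact absurd rfl hw
  | append_singleton w b ih =>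
    rw [wordVal_concat] at hw ⊢
    rw [List.length_append, List.length_singleton, mul_add_one, mul_comm 2 (wordVal w)]
    by_cases h : wordVal w = 0
    · cases b
      · simp [h] at hw
      · simpa [h] using hasCount_zero_one.mono (Nat.zero_le _)
    · cases b
      · exact ((ih h).mul (hasCount_two_pow 1)).mono (by omega)
      · exact (ih h).append (hasPointedCount_two_pow 1)

/-- The number with binary digits `l`, if positive, is the number of closed sets of a relation on
at most `m` points. -/
def WordCount (m : ℕ) (l : List Bool) : Prop := wordVal l ≠ 0 → HasCount m (wordVal l)

theorem WordCount.mono {m m' : ℕ} {l : List Bool} (h : WordCount m l) (hm : m ≤ m') :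
    WordCount m' l := fun h0 => (h h0).mono hm

theorem WordCount.append_wordPow {m : ℕ} {l : List Bool} (h : WordCount m l) (w : List Bool)
    (q : ℕ) : WordCount (m + (q * (w.length + 1) + 2 * w.length)) (l ++ wordPow w q) := by
  rcases q with _ | q
  · rw [wordPow_zero, List.append_nil]
    exact h.mono (Nat.le_add_right _ _)
  intro h0
  rw [wordVal_append, wordVal_wordPow, length_wordPow, pow_mul] at h0 ⊢
  -- A prefix or word of value zero has no relation counting it, so these cases use a plain product.
  by_cases hl : wordVal l = 0
  · rw [hl, zero_mul, zero_add] at h0 ⊢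
    exact ((hasCount_geomSum _ q).mul (hasCount_wordVal w (right_ne_zero_of_mul h0))).mono
      (Nat.le_add_left _ _)
  by_cases hw : wordVal w = 0
  · rw [hw, mul_zero, add_zero, ← pow_mul]
    refine ((h hl).mul (hasCount_two_pow _)).mono ?_
    nlinarith
  · exact (h hl).append ((hasPointedCount_geomSum _ q).attach (hasCount_wordVal w hw))

/-- Grouping the repetitions into blocks of `t` copies makes the overhead a small fraction. -/
theorem WordCount.append_wordPow_blocks {m : ℕ} {l : List Bool} (h : WordCount m l)
    (w : List Bool) (q t : ℕ) (ht : 0 < t) :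
    WordCount (m + (w.length * q + w.length * (q / t) + w.length * (4 * t + 1)))
      (l ++ wordPow w q) := by
  -- Each block costs an extra point, which is charged to `w.length ≥ 1`.
  rcases w.length.eq_zero_or_pos with hw | hw
  · have : wordPow w q = [] := List.eq_nil_of_length_eq_zero (by rw [length_wordPow, hw, zero_mul])
    rw [this, List.append_nil]
    exact h.mono (Nat.le_add_right _ _)
  -- `q / t` blocks `w^(t)`, then the remainder `w^(q % t)` as a single word.
  have key := (h.append_wordPow (wordPow w t) (q / t)).append_wordPow (wordPow w (q % t)) 1
  rw [wordPow_one, List.append_assoc, ← wordPow_mul, ← wordPow_add, Nat.div_add_mod] at key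
  refine key.mono ?_
  rw [length_wordPow, length_wordPow]
  have h1 := Nat.div_add_mod q t
  have h2 := Nat.mod_lt q ht
  generalize q / t = a at *
  generalize q % t = b at *
  subst h1
  nlinarith [Nat.mul_le_mul_left w.length h2.le, Nat.mul_le_mul_right a hw]

theorem wordCount_flatten (t : ℕ) (ht : 0 < t) (L : List (List Bool × ℕ)) :
    WordCount ((L.map fun x => x.1.length * x.2 + x.1.length * (x.2 / t) +
      x.1.length * (4 * t + 1)).sum) (L.map fun x => wordPow x.1 x.2).flatten := by
  induction L using List.reverseRecOn with
  | nil => exact fun h => absurd rfl h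
  | append_singleton L x ih =>
    simpa using ih.append_wordPow_blocks x.1 x.2 t ht

theorem hasCount_of_binaryRep_eq {n k : ℕ} (hn : n ≠ 0) (w : Fin k → List Bool) (q : Fin k → ℕ)
    (h : binaryRep n = (List.ofFn fun i => wordPow (w i) (q i)).flatten) (t : ℕ) (ht : 0 < t) :
    HasCount (n.size + n.size / t + (4 * t + 1) * ∑ i, (w i).length) n := by
  have key := wordCount_flatten t ht (List.ofFn fun i => (w i, q i))
  simp only [List.map_ofFn, Function.comp_def] at key
  rw [← h, WordCount, wordVal_binaryRep] at key
  refine (key hn).mono ?_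
  have hsize : n.size = ∑ i, (w i).length * q i := by
    rw [← length_binaryRep, h, List.length_flatten, List.map_ofFn, List.sum_ofFn]
    simp [length_wordPow]
  have hdiv : ∑ i, (w i).length * (q i / t) ≤ n.size / t := by
    rw [Nat.le_div_iff_mul_le ht, hsize, Finset.sum_mul]
    refine Finset.sum_le_sum fun i _ => ?_
    rw [mul_assoc]
    exact Nat.mul_le_mul_left _ (Nat.div_mul_le_self _ _)
  rw [List.sum_ofFn, Finset.sum_add_distrib, Finset.sum_add_distrib, ← hsize, ← Finset.sum_mul,
    mul_comm (∑ i, (w i).length)]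
  gcongr

/-! ### Asymptotics -/

theorem Nat.size_le_logb_add_one {n : ℕ} (hn : n ≠ 0) : (n.size : ℝ) ≤ Real.logb 2 n + 1 := by
  have hpos : 0 < n.size := Nat.size_pos.2 (Nat.pos_of_ne_zero hn)
  have h : 2 ^ (n.size - 1) ≤ n := Nat.lt_size.1 (by omega)
  have h' : ((n.size - 1 : ℕ) : ℝ) ≤ Real.logb 2 n := by
    rw [Real.le_logb_iff_rpow_le one_lt_two (by positivity), Real.rpow_natCast]
    exact_mod_cast h
  rw [Nat.cast_pred hpos] at h'
  linarith

theorem HasCount.two_mul_logb_le {m n : ℕ} (h : HasCount m n) (hn : n ≠ 0) :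
    2 * Real.logb 2 n ≤ minBipartiteOrder n := by
  have h1 : (n : ℝ) ^ 2 ≤ 2 ^ minBipartiteOrder n := by exact_mod_cast h.sq_le_two_pow
  have h2 : Real.logb 2 ((n : ℝ) ^ 2) ≤ minBipartiteOrder n := by
    rwa [Real.logb_le_iff_le_rpow one_lt_two (by positivity), Real.rpow_natCast]
  simpa [Real.logb_pow] using h2

theorem mainTheorem1
    (n : ℕ → ℕ) (hn : Tendsto n atTop atTop)
    (k : ℕ → ℕ) (w : (j : ℕ) → Fin (k j) → List Bool) (q : (j : ℕ) → Fin (k j) → ℕ)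
    (hrep : ∀ j, binaryRep (n j) = (List.ofFn fun i => wordPow (w j i) (q j i)).flatten)
    (hp : (fun j => ∑ i, ((w j i).length : ℝ)) =o[atTop] fun j => Real.log (n j)) :
    (fun j => (minBipartiteOrder (n j) : ℝ)) ~[atTop] fun j => 2 * Real.logb 2 (n j) := by
  have hlog : Tendsto (fun j => Real.logb 2 (n j)) atTop atTop :=
    (Real.tendsto_logb_atTop one_lt_two).comp (tendsto_natCast_atTop_atTop.comp hn)
  rw [IsEquivalent, isLittleO_iff]
  intro ε hε
  obtain ⟨T, hT⟩ := exists_nat_gt (2 / ε)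
  have hT0 : (0 : ℝ) < T := lt_trans (by positivity) hT
  have hTpos : 0 < T := by exact_mod_cast hT0
  have hTε : 2 / (T : ℝ) ≤ ε := by
    rw [div_lt_iff₀ hε] at hT
    rw [div_le_iff₀ hT0]
    linarith
  -- Chosen so that the term with factor `4 * T + 1` is at most `ε / 4 * ℓ`.
  set δ : ℝ := ε / (4 * (4 * T + 1)) with hδ
  have hδ0 : 0 < δ := by positivity
  filter_upwards [isLittleO_iff.1 hp hδ0, hlog.eventually_ge_atTop 4,
    hlog.eventually_ge_atTop (8 / ε), hn.eventually_ne_atTop 0] with j hpj hl4 hlε hnj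
  have hc := hasCount_of_binaryRep_eq hnj (w j) (q j) (hrep j) T hTpos
  have hlow := hc.two_mul_logb_le hnj
  have hup : (minBipartiteOrder (n j) : ℝ) ≤
      2 * ((n j).size + (n j).size / T + (4 * T + 1) * ∑ i, ((w j i).length : ℝ)) := by
    have h1 : (minBipartiteOrder (n j) : ℝ) ≤ _ := Nat.cast_le.2 hc.minBipartiteOrder_le
    push_cast at h1
    have h2 : (((n j).size / T : ℕ) : ℝ) ≤ ((n j).size : ℝ) / T := Nat.cast_div_le
    linarith
  have hsize := Nat.size_le_logb_add_one hnj
  have hP : ∑ i, ((w j i).length : ℝ) ≤ δ * Real.logb 2 (n j) := by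
    have hln : Real.log (n j) = Real.logb 2 (n j) * Real.log 2 :=
      (div_mul_cancel₀ _ (Real.log_pos one_lt_two).ne').symm
    have hln_le : ‖Real.log (n j)‖ ≤ Real.logb 2 (n j) := by
      rw [Real.norm_of_nonneg (Real.log_natCast_nonneg _), hln]
      exact mul_le_of_le_one_right (by linarith) (by linarith [Real.log_two_lt_d9])
    exact (Real.le_norm_self _).trans (hpj.trans (mul_le_mul_of_nonneg_left hln_le hδ0.le))
  simp only [Pi.sub_apply]
  generalize Real.logb 2 (n j) = ℓ at *
  have hPT : (4 * T + 1) * ∑ i, ((w j i).length : ℝ) ≤ ε / 4 * ℓ := by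
    refine (mul_le_mul_of_nonneg_left hP (by positivity)).trans_eq ?_
    rw [hδ]
    field_simp
  have hdiv : 2 * (((n j).size : ℝ) / T) ≤ ε * (ℓ + 1) := by
    calc 2 * (((n j).size : ℝ) / T) = 2 / T * (n j).size := by ring
      _ ≤ ε * (ℓ + 1) := mul_le_mul hTε hsize (by positivity) hε.le
  have h8 : 8 ≤ ε * ℓ := by
    rw [div_le_iff₀ hε] at hlε
    linarith
  -- The excess is at most `2 + ε + (3 / 2) * ε * ℓ`; `h8` and `h4` bound `2` and `ε` by `ε * ℓ / 4`
  -- each, giving `2 * ε * ℓ`.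
  have h4 : ε * 4 ≤ ε * ℓ := mul_le_mul_of_nonneg_left hl4 hε.le
  rw [Real.norm_of_nonneg (by linarith), Real.norm_of_nonneg (by linarith)]
  linarith
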